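/- Theorem 4.1 (unconditional case, Fradelizi–Meyer). Let \(V:\mathbb{R}^n\to\mathbb{R}\cup\{+\infty\}\) be a convex function which is unconditional, that is, \[ V(x_1,\ldots,x_n)=V(|x_1|,\ldots,|x_n|)\qquad\text{for all } x\in\mathbb{R}^n, \] and suppose that \(0<\int_{\mathbb{R}^n}e^{-V}\,dx<\infty\) (with the convention \(e^{-\infty}=0\)). Let \[ V^*(y)=\sup_{x\in\mathbb{R}^n}\{x\cdot y-V(x)\},\qquad y\in\mathbb{R}^n, \] be the Fenchel–Legendre transform of \(V\). Then \[ \int_{\mathbb{R}^n}e^{-V}\,dx\int_{\mathbb{R}^n}e^{-V^*}\,dx\ \ge\ 4^n . \] -/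

import Mathlib

open MeasureTheory

/-- Convexity of an extended-real-valued function `V : ℝⁿ → ℝ ∪ {+∞}`: the usual inequality along
every segment, with the arithmetic of `EReal` (for functions that never take the value `-∞` no
indeterminate sum `∞ - ∞` occurs). -/
def ConvexFun {n : ℕ} (V : EuclideanSpace ℝ (Fin n) → EReal) : Prop :=
  ∀ x y : EuclideanSpace ℝ (Fin n), ∀ a b : ℝ, 0 < a → 0 < b → a + b = 1 →
    V (a • x + b • y) ≤ (a : EReal) * V x + (b : EReal) * V y

/-- `V` is unconditional: `V (x₁, …, xₙ) = V (|x₁|, …, |xₙ|)` for every `x`. -/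
def Unconditional {n : ℕ} (V : EuclideanSpace ℝ (Fin n) → EReal) : Prop :=
  ∀ x : EuclideanSpace ℝ (Fin n), V x = V (WithLp.toLp 2 fun i => |x i|)

/-- The Fenchel-Legendre transform `V* (y) = sup_x (x · y - V x)`, the supremum being taken in the
extended reals. -/
noncomputable def legendre {n : ℕ} (V : EuclideanSpace ℝ (Fin n) → EReal)
    (y : EuclideanSpace ℝ (Fin n)) : EReal :=
  ⨆ x : EuclideanSpace ℝ (Fin n), ((inner ℝ x y : ℝ) : EReal) - V x

/-- The integral `∫ e^{-V} dx` over `ℝⁿ` with respect to Lebesgue measure, as an element of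
`[0, ∞]`, with `e^{-∞} = 0`. -/
noncomputable def expIntegral {n : ℕ} (V : EuclideanSpace ℝ (Fin n) → EReal) : ENNReal :=
  ∫⁻ x, EReal.exp (-(V x)) ∂volume

/-!
On the orthant `[0, ∞)ⁿ` an unconditional convex `V`, normalized by `V 0 = 0`, is described by
`f = e^{-V}`: a log-concave, coordinatewise nonincreasing function with `f 0 = 1`
(`OrthantProfile`). As `∫_{ℝⁿ} e^{-V}` is `2ⁿ` times the integral over the orthant, and `e^{-V*}` is
at least the `polar` of `f` at `|y|`, the claim is that `∫ f · ∫ polar f ≥ 1` over the orthant.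

The proof is an induction on the dimension, with coordinate sections `fᵢ = f|_{xᵢ = 0}`, in the
spirit of Meyer's argument for unconditional bodies. Write `a(t) = tⁿ ∫ f ^ t`,
`aᵢ(t) = tⁿ⁻¹ ∫ fᵢ ^ t`, and `b`, `bᵢ` for the same quantities for `g = polar f`. For a point `z` of
the orthant, cutting the orthant into the translate `w + [0, ∞)ⁿ` with `w = (1 - s / t) z` and slabs
of width `wᵢ` along its faces yields (`OrthantProfile.powIntegral_ge`)
`a(t) ≥ f(z)^(t - s) (a(s) + (t - s) ∑ zᵢ aᵢ(s))` for `s < t`, and in the limit `t ↓ s`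
(`OrthantProfile.log_mul_add_le_deriv`)
`a' ≥ a log f(z) + ∑ zᵢ aᵢ`.
As this holds for all `z`, the definition of the polar gives `g(y) ≥ e^{-a' / a}` at `y = (aᵢ / a)ᵢ`
(`OrthantProfile.exp_neg_le_polar`). Inserting this `y` into the same inequality for `g`,
`b' ≥ b log g(y) + ∑ yᵢ bᵢ`, leads to `(a b)' ≥ ∑ aᵢ bᵢ`.

By induction `aᵢ bᵢ ≥ tⁿ⁻¹`, so `(a b)' ≥ n tⁿ⁻¹`, and since `a b ≥ 0` near `t = 0` it follows that
`a(t) b(t) ≥ tⁿ` for all `t > 0` (`OrthantProfile.pow_le_scaled_mul_scaled`). The statement for all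
`t` is what the induction needs; the theorem is the case `t = 1`.
-/

/-! ### Profiles on the orthant -/

/-- The functions `f = e^{-V}` on the orthant `[0, ∞)ⁿ` which come from an unconditional convex
`V` with `V 0 = 0`: `f` is nonnegative, coordinatewise nonincreasing and log-concave, and `f 0 = 1`.
Only the values of `f` on the orthant matter. -/
structure OrthantProfile {n : ℕ} (f : (Fin n → ℝ) → ℝ) : Prop where
  nonneg : ∀ x, 0 ≤ f x
  zero : f 0 = 1
  anti : ∀ x y, 0 ≤ x → x ≤ y → f y ≤ f x
  logConcave : ∀ x y, 0 ≤ x → 0 ≤ y → ∀ a b : ℝ, 0 < a → 0 < b → a + b = 1 →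
    f x ^ a * f y ^ b ≤ f (a • x + b • y)

/-- The integral `∫ f ^ t` over the orthant `[0, ∞)ⁿ`. -/
noncomputable def powIntegral {n : ℕ} (f : (Fin n → ℝ) → ℝ) (t : ℝ) : ENNReal :=
  ∫⁻ x in Set.Ici (0 : Fin n → ℝ), ENNReal.ofReal (f x ^ t)

/-- The restriction of `f` to the coordinate hyperplane `x i = 0`. -/
def coordSection {m : ℕ} (f : (Fin (m + 1) → ℝ) → ℝ) (i : Fin (m + 1)) (x : Fin m → ℝ) : ℝ :=
  f (i.insertNth 0 x)

lemma OrthantProfile.le_one {n : ℕ} {f : (Fin n → ℝ) → ℝ} (hf : OrthantProfile f)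
    {x : Fin n → ℝ} (hx : 0 ≤ x) : f x ≤ 1 :=
  hf.zero ▸ hf.anti 0 x le_rfl hx

/-- The superlevel sets are convex, hence null measurable. -/
lemma OrthantProfile.aemeasurable {n : ℕ} {f : (Fin n → ℝ) → ℝ} (hf : OrthantProfile f) :
    AEMeasurable f (volume.restrict (Set.Ici (0 : Fin n → ℝ))) := by
  refine NullMeasurable.aemeasurable ?_
  refine @measurable_of_Ioi ℝ (NullMeasurableSpace (Fin n → ℝ)
    (volume.restrict (Set.Ici 0))) _ _ _ _ _ _ _ f fun c => ?_
  have hconv : Convex ℝ {x : Fin n → ℝ | 0 ≤ x ∧ c < f x} := by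
    rw [convex_iff_forall_pos]
    rintro x ⟨hx, hcx⟩ y ⟨hy, hcy⟩ a b ha hb hab
    refine ⟨add_nonneg (smul_nonneg ha.le hx) (smul_nonneg hb.le hy), ?_⟩
    rcases lt_or_ge c 0 with hc | hc
    · exact hc.trans_le (hf.nonneg _)
    · refine lt_of_lt_of_le ?_ (hf.logConcave x y hx hy a b ha hb hab)
      calc c = c ^ a * c ^ b := by
            rw [← Real.rpow_add_of_nonneg hc ha.le hb.le, hab, Real.rpow_one]
        _ < f x ^ a * f y ^ b := by
            have h1 := Real.rpow_lt_rpow hc hcx ha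
            have h2 := Real.rpow_lt_rpow hc hcy hb
            have := Real.rpow_nonneg hc a
            have := Real.rpow_nonneg hc b
            nlinarith
  have h := (hconv.nullMeasurableSet (volume : Measure (Fin n → ℝ))).mono_ac
    (Measure.restrict_le_self (s := Set.Ici 0)).absolutelyContinuous
  refine h.congr ?_
  filter_upwards [ae_restrict_mem measurableSet_Ici] with x hx
  exact propext ⟨fun h => h.2, fun h => ⟨hx, h⟩⟩

lemma OrthantProfile.aemeasurable_rpow {n : ℕ} {f : (Fin n → ℝ) → ℝ} (hf : OrthantProfile f)
    (t : ℝ) : AEMeasurable (fun x => ENNReal.ofReal (f x ^ t))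
      (volume.restrict (Set.Ici (0 : Fin n → ℝ))) :=
  (hf.aemeasurable.pow_const t).ennreal_ofReal

lemma insertNth_zero_nonneg {m : ℕ} (i : Fin (m + 1)) {x : Fin m → ℝ} (hx : 0 ≤ x) :
    (0 : Fin (m + 1) → ℝ) ≤ i.insertNth (0 : ℝ) x := by
  rw [Fin.le_insertNth_iff]
  exact ⟨le_rfl, hx⟩

lemma OrthantProfile.profile_coordSection {m : ℕ} {f : (Fin (m + 1) → ℝ) → ℝ}
    (hf : OrthantProfile f) (i : Fin (m + 1)) : OrthantProfile (coordSection f i) where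
  nonneg x := hf.nonneg _
  zero := by
    have : (i.insertNth (0 : ℝ) (0 : Fin m → ℝ) : Fin (m + 1) → ℝ) = 0 := by
      rw [Fin.insertNth_eq_iff]; exact ⟨rfl, rfl⟩
    rw [coordSection, this, hf.zero]
  anti x y hx hxy := by
    refine hf.anti _ _ (insertNth_zero_nonneg i hx) ?_
    rw [Fin.insertNth_le_iff]
    simpa [Fin.removeNth] using hxy
  logConcave x y hx hy a b ha hb hab := by
    have := hf.logConcave _ _ (insertNth_zero_nonneg i hx) (insertNth_zero_nonneg i hy)
      a b ha hb hab
    refine this.trans (le_of_eq ?_)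
    rw [coordSection]
    congr 1
    symm
    rw [Fin.insertNth_eq_iff]
    constructor
    · simp
    · ext j; simp [Fin.removeNth]

/-! ### Slicing the orthant -/

/-- The change of variables `u = w + r x` on orthants. -/
lemma setLIntegral_Ici_affine {n : ℕ} (w : Fin n → ℝ) {r : ℝ} (hr : 0 < r)
    (F : (Fin n → ℝ) → ENNReal) :
    ∫⁻ u in Set.Ici w, F u
      = ENNReal.ofReal (r ^ n) * ∫⁻ x in Set.Ici (0 : Fin n → ℝ), F (w + r • x) := by
  have hscale : ∀ G : (Fin n → ℝ) → ENNReal,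
      ∫⁻ u, G u = ENNReal.ofReal (r ^ n) * ∫⁻ x, G (r • x) := by
    intro G
    have h := Measure.map_addHaar_smul (volume : Measure (Fin n → ℝ)) hr.ne'
    have h2 := lintegral_map_equiv (μ := (volume : Measure (Fin n → ℝ))) G
      (Homeomorph.smulOfNeZero r hr.ne').toMeasurableEquiv
    change ∫⁻ a, G a ∂(Measure.map (fun x => r • x) volume) = ∫⁻ a, G (r • a) at h2
    rw [h, lintegral_smul_measure] at h2
    rw [← h2, smul_eq_mul, ← mul_assoc, ← ENNReal.ofReal_mul (by positivity)]
    rw [Module.finrank_fin_fun, abs_of_pos (by positivity), mul_inv_cancel₀ (by positivity)]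
    simp
  rw [← lintegral_indicator measurableSet_Ici, ← lintegral_indicator measurableSet_Ici,
    ← lintegral_add_left_eq_self _ w, hscale]
  congr 1
  refine lintegral_congr fun x => ?_
  have : w + r • x ∈ Set.Ici w ↔ x ∈ Set.Ici (0 : Fin n → ℝ) := by
    simp [Pi.le_def, hr]
  by_cases hx : x ∈ Set.Ici (0 : Fin n → ℝ)
  · rw [Set.indicator_of_mem hx, Set.indicator_of_mem (this.2 hx)]
  · rw [Set.indicator_of_notMem hx, Set.indicator_of_notMem (fun h => hx (this.1 h))]

/-- Fubini for a slab: integrating a function of the coordinates other than `i`. -/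
lemma setLIntegral_slab {m : ℕ} (i : Fin (m + 1)) (w : Fin (m + 1) → ℝ)
    (H : (Fin m → ℝ) → ENNReal) (hH : AEMeasurable H (volume.restrict (Set.Ici (i.removeNth w)))) :
    ∫⁻ u in {u : Fin (m + 1) → ℝ | u i ∈ Set.Ico 0 (w i) ∧ i.removeNth w ≤ i.removeNth u},
      H (i.removeNth u)
      = ENNReal.ofReal (w i) * ∫⁻ x in Set.Ici (i.removeNth w), H x := by
  have h := (volume_preserving_piFinSuccAbove (fun _ : Fin (m + 1) => ℝ) i)
  have h2 := h.setLIntegral_comp_preimage_emb (MeasurableEquiv.measurableEmbedding _)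
    (fun p => H p.2) (Set.Ico 0 (w i) ×ˢ Set.Ici (i.removeNth w))
  have hset : {u : Fin (m + 1) → ℝ | u i ∈ Set.Ico 0 (w i) ∧ i.removeNth w ≤ i.removeNth u}
      = (MeasurableEquiv.piFinSuccAbove (fun _ : Fin (m + 1) => ℝ) i) ⁻¹'
        (Set.Ico 0 (w i) ×ˢ Set.Ici (i.removeNth w)) := by
    ext u; rfl
  rw [hset]
  refine h2.trans ?_
  rw [Measure.volume_eq_prod, ← Measure.prod_restrict]
  have h3 := lintegral_prod_mul (μ := (volume : Measure ℝ).restrict (Set.Ico 0 (w i)))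
    (f := fun _ => 1) aemeasurable_const hH
  simpa using h3

/-- Log-concavity between `x` and `z`, raised to the power `t`, at the point dividing the segment
in the ratio `s : t - s`. -/
lemma OrthantProfile.rpow_mul_rpow_le {n : ℕ} {f : (Fin n → ℝ) → ℝ} (hf : OrthantProfile f)
    {x z : Fin n → ℝ} (hx : 0 ≤ x) (hz : 0 ≤ z) {s t : ℝ} (hs : 0 < s) (hst : s < t) :
    f z ^ (t - s) * f x ^ s ≤ f ((1 - s / t) • z + (s / t) • x) ^ t := by
  have ht : 0 < t := hs.trans hst
  have h1 : 0 < 1 - s / t := by rw [sub_pos, div_lt_one ht]; exact hst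
  have h := hf.logConcave z x hz hx (1 - s / t) (s / t) h1 (by positivity) (by ring)
  have h2 := Real.rpow_le_rpow (mul_nonneg (Real.rpow_nonneg (hf.nonneg _) _)
    (Real.rpow_nonneg (hf.nonneg _) _)) h ht.le
  rw [Real.mul_rpow (Real.rpow_nonneg (hf.nonneg _) _) (Real.rpow_nonneg (hf.nonneg _) _),
    ← Real.rpow_mul (hf.nonneg _), ← Real.rpow_mul (hf.nonneg _)] at h2
  have e1 : (1 - s / t) * t = t - s := by field_simp
  have e2 : s / t * t = s := by field_simp
  rwa [e1, e2] at h2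

/-- The orthant contains the translate `w + [0, ∞)ⁿ` and the slabs
`{0 ≤ u i < w i, w j ≤ u j for j ≠ i}`, which are pairwise disjoint. -/
lemma setLIntegral_translate_add_slabs_le {m : ℕ} {w : Fin (m + 1) → ℝ} (hw : 0 ≤ w)
    (F : (Fin (m + 1) → ℝ) → ENNReal) :
    (∫⁻ u in Set.Ici w, F u) + ∑ i, ∫⁻ u in {u : Fin (m + 1) → ℝ | u i ∈ Set.Ico 0 (w i) ∧
      i.removeNth w ≤ i.removeNth u}, F u ≤ ∫⁻ u in Set.Ici 0, F u := by
  set T : Fin (m + 1) → Set (Fin (m + 1) → ℝ) := fun i =>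
    {u | u i ∈ Set.Ico 0 (w i) ∧ i.removeNth w ≤ i.removeNth u} with hT
  have hTm : ∀ i, MeasurableSet (T i) := by
    intro i
    refine MeasurableSet.inter ?_ ?_
    · exact measurableSet_Ico.preimage (measurable_pi_apply i)
    · have : Measurable (fun u : Fin (m + 1) → ℝ => i.removeNth u) :=
        measurable_pi_lambda _ fun j => measurable_pi_apply _
      exact measurableSet_Ici.preimage this
  have hle : ∀ {i j : Fin (m + 1)} {u}, u ∈ T i → j ≠ i → w j ≤ u j := by
    intro i j u hu hji
    obtain ⟨k, rfl⟩ := Fin.exists_succAbove_eq hji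
    exact hu.2 k
  have hd : Pairwise (Function.onFun Disjoint T) := by
    intro i j hij
    rw [Function.onFun, Set.disjoint_left]
    intro u hi hj
    exact absurd hi.1.2 (not_lt.2 (hle hj hij))
  rw [← tsum_fintype (L := SummationFilter.unconditional _),
    ← lintegral_iUnion hTm hd, ← lintegral_union (MeasurableSet.iUnion hTm)]
  · refine lintegral_mono_set ?_
    rintro u (hu | hu)
    · exact le_trans hw hu
    · obtain ⟨i, hi⟩ := Set.mem_iUnion.1 hu
      intro j
      by_cases hj : j = i
      · subst hj; exact hi.1.1
      · exact (hw j).trans (hle hi hj)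
  · rw [Set.disjoint_left]
    intro u hu hu'
    obtain ⟨i, hi⟩ := Set.mem_iUnion.1 hu'
    exact absurd hi.1.2 (not_lt.2 (hu i))

/-- Slicing the orthant at `w = (1 - s / t) z`: on `w + [0, ∞)ⁿ` log-concavity bounds `f ^ t` below
by a rescaled `f ^ s`, and on the slab of width `w i` at the face `u i = 0` monotonicity and
log-concavity bound it below by a rescaled copy of the section of `f ^ s` at that face. -/
lemma OrthantProfile.powIntegral_ge {m : ℕ} {f : (Fin (m + 1) → ℝ) → ℝ} (hf : OrthantProfile f)
    {z : Fin (m + 1) → ℝ} (hz : 0 ≤ z) {s t : ℝ} (hs : 0 < s) (hst : s < t) :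
    ENNReal.ofReal (f z ^ (t - s)) * (ENNReal.ofReal (s ^ (m + 1)) * powIntegral f s
      + ∑ i, ENNReal.ofReal ((t - s) * z i * s ^ m) * powIntegral (coordSection f i) s)
      ≤ ENNReal.ofReal (t ^ (m + 1)) * powIntegral f t := by
  have ht : 0 < t := hs.trans hst
  have hr : 0 < s / t := div_pos hs ht
  have h1 : 0 < 1 - s / t := by rw [sub_pos, div_lt_one ht]; exact hst
  set w : Fin (m + 1) → ℝ := (1 - s / t) • z with hwdef
  have hw : 0 ≤ w := smul_nonneg h1.le hz
  have key := setLIntegral_translate_add_slabs_le hw (fun u => ENNReal.ofReal (f u ^ t))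
  have hc : 0 ≤ f z ^ (t - s) := Real.rpow_nonneg (hf.nonneg _) _
  have hmain : ENNReal.ofReal ((s / t) ^ (m + 1)) * (ENNReal.ofReal (f z ^ (t - s)) *
      powIntegral f s) ≤ ∫⁻ u in Set.Ici w, ENNReal.ofReal (f u ^ t) := by
    rw [setLIntegral_Ici_affine w hr, powIntegral, ← lintegral_const_mul' _ _ ENNReal.ofReal_ne_top]
    gcongr ENNReal.ofReal _ * ?_
    refine setLIntegral_mono_ae' measurableSet_Ici (Filter.Eventually.of_forall fun x hx => ?_)
    rw [← ENNReal.ofReal_mul hc]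
    exact ENNReal.ofReal_le_ofReal (hf.rpow_mul_rpow_le hx hz hs hst)
  have hslab : ∀ i, ENNReal.ofReal (w i) * (ENNReal.ofReal ((s / t) ^ m) *
      (ENNReal.ofReal (f z ^ (t - s)) * powIntegral (coordSection f i) s)) ≤
      ∫⁻ u in {u : Fin (m + 1) → ℝ | u i ∈ Set.Ico 0 (w i) ∧ i.removeNth w ≤ i.removeNth u},
        ENNReal.ofReal (f u ^ t) := by
    intro i
    have hfi := hf.profile_coordSection i
    -- the value of `f` on the inner face `u i = w i` of the slab
    set H : (Fin m → ℝ) → ENNReal := fun u' => ENNReal.ofReal (f (i.insertNth (w i) u') ^ t) with hH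
    have hHlow : ∀ x : Fin m → ℝ, 0 ≤ x → ENNReal.ofReal (f z ^ (t - s)) *
        ENNReal.ofReal (coordSection f i x ^ s) ≤ H (i.removeNth w + (s / t) • x) := by
      intro x hx
      rw [← ENNReal.ofReal_mul hc]
      refine ENNReal.ofReal_le_ofReal ?_
      refine (hf.rpow_mul_rpow_le (insertNth_zero_nonneg i hx) hz hs hst).trans (le_of_eq ?_)
      congr 2
      symm
      rw [Fin.insertNth_eq_iff]
      constructor
      · simp [hwdef]
      · ext j; simp [Fin.removeNth, hwdef]
    -- a measurable minorant of `H`, obtained by undoing the substitution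
    set G : (Fin m → ℝ) → ENNReal := fun u' => ENNReal.ofReal (f z ^ (t - s)) *
      ENNReal.ofReal (coordSection f i ((s / t)⁻¹ • (u' - i.removeNth w)) ^ s) with hG
    have hGval : ∀ x : Fin m → ℝ, G (i.removeNth w + (s / t) • x) =
        ENNReal.ofReal (f z ^ (t - s)) * ENNReal.ofReal (coordSection f i x ^ s) := by
      intro x
      simp only [hG, add_sub_cancel_left]
      rw [inv_smul_smul₀ hr.ne']
    have hGint : ∫⁻ u in Set.Ici (i.removeNth w), G u = ENNReal.ofReal ((s / t) ^ m) *
        (ENNReal.ofReal (f z ^ (t - s)) * powIntegral (coordSection f i) s) := by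
      rw [setLIntegral_Ici_affine _ hr, powIntegral]
      simp_rw [hGval]
      rw [lintegral_const_mul' _ _ ENNReal.ofReal_ne_top]
    have hGm : AEMeasurable G (volume.restrict (Set.Ici (i.removeNth w))) := by
      refine AEMeasurable.const_mul ?_ _
      have hφ : Measure.QuasiMeasurePreserving
          (fun u' : Fin m → ℝ => (s / t)⁻¹ • (u' - i.removeNth w))
          (volume.restrict (Set.Ici (i.removeNth w))) (volume.restrict (Set.Ici 0)) := by
        have hsub := (measurePreserving_sub_right (volume : Measure (Fin m → ℝ))
          (i.removeNth w)).quasiMeasurePreserving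
        have hsm : Measure.QuasiMeasurePreserving (fun u' : Fin m → ℝ => (s / t)⁻¹ • u')
            volume volume := by
          refine ⟨by fun_prop, ?_⟩
          have h := Measure.map_addHaar_smul (volume : Measure (Fin m → ℝ)) (inv_ne_zero hr.ne')
          change Measure.map (fun x => (s / t)⁻¹ • x) volume = _ at h
          rw [h]
          exact Measure.smul_absolutelyContinuous
        refine (hsm.comp hsub).restrict ?_
        intro u hu
        exact smul_nonneg (inv_nonneg.2 hr.le) (sub_nonneg.2 (Set.mem_Ici.1 hu))
      exact (hfi.aemeasurable_rpow s).comp_quasiMeasurePreserving hφ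
    rw [← hGint, ← setLIntegral_slab i w G hGm]
    refine setLIntegral_mono_ae' ?_ (Filter.Eventually.of_forall fun u hu => ?_)
    · refine MeasurableSet.inter (measurableSet_Ico.preimage (measurable_pi_apply i)) ?_
      have : Measurable (fun u : Fin (m + 1) → ℝ => i.removeNth u) :=
        measurable_pi_lambda _ fun j => measurable_pi_apply _
      exact measurableSet_Ici.preimage this
    · obtain ⟨hui, hu'⟩ := hu
      have hx : 0 ≤ (s / t)⁻¹ • (i.removeNth u - i.removeNth w) :=
        smul_nonneg (inv_nonneg.2 hr.le) (sub_nonneg.2 hu')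
      refine (hHlow _ hx).trans ?_
      rw [smul_inv_smul₀ hr.ne', add_sub_cancel]
      refine ENNReal.ofReal_le_ofReal (Real.rpow_le_rpow (hf.nonneg _) ?_ ht.le)
      refine hf.anti _ _ ?_ ?_
      · intro j
        by_cases hj : j = i
        · subst hj; exact hui.1
        · obtain ⟨k, rfl⟩ := Fin.exists_succAbove_eq hj
          exact (hw _).trans (hu' k)
      · rw [Fin.le_insertNth_iff]
        exact ⟨hui.2.le, le_rfl⟩
  have hsum := (add_le_add hmain (Finset.sum_le_sum fun i (_ : i ∈ Finset.univ) =>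
    hslab i)).trans key
  have hfinal := mul_le_mul_right hsum (ENNReal.ofReal (t ^ (m + 1)))
  refine le_trans (le_of_eq ?_) hfinal
  rw [mul_add, mul_add, Finset.mul_sum, Finset.mul_sum]
  congr 1
  · have : s ^ (m + 1) = t ^ (m + 1) * (s / t) ^ (m + 1) := by
      rw [← mul_pow]; congr 1; field_simp
    rw [this, ENNReal.ofReal_mul (by positivity)]
    ring
  · refine Finset.sum_congr rfl fun i _ => ?_
    have hwi : 0 ≤ w i := hw i
    have : (t - s) * z i * s ^ m = t ^ (m + 1) * (w i * (s / t) ^ m) := by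
      rw [hwdef, Pi.smul_apply, smul_eq_mul, div_pow]
      field_simp
      ring
    rw [this, ENNReal.ofReal_mul (by positivity), ENNReal.ofReal_mul hwi]
    ring

/-! ### Positivity and finiteness of the integrals -/

lemma OrthantProfile.powIntegral_pos {n : ℕ} {f : (Fin n → ℝ) → ℝ} (hf : OrthantProfile f)
    {z : Fin n → ℝ} (hz : ∀ i, 0 < z i) (hfz : 0 < f z) {t : ℝ} (ht : 0 < t) :
    0 < powIntegral f t := by
  have h1 : ∫⁻ _ in Set.Icc 0 z, ENNReal.ofReal (f z ^ t) ≤ powIntegral f t := by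
    refine le_trans ?_ (lintegral_mono_set (s := Set.Icc 0 z) Set.Icc_subset_Ici_self)
    refine setLIntegral_mono_ae' measurableSet_Icc (Filter.Eventually.of_forall fun x hx => ?_)
    exact ENNReal.ofReal_le_ofReal (Real.rpow_le_rpow (hf.nonneg _) (hf.anti _ _ hx.1 hx.2) ht.le)
  refine lt_of_lt_of_le ?_ h1
  rw [setLIntegral_const, Real.volume_Icc_pi]
  refine ENNReal.mul_pos ?_ ?_
  · simpa using Real.rpow_pos_of_pos hfz t
  · rw [Finset.prod_ne_zero_iff]
    intro i _
    simpa using hz i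

lemma OrthantProfile.rpow_le_rpow {n : ℕ} {f : (Fin n → ℝ) → ℝ} (hf : OrthantProfile f)
    {x : Fin n → ℝ} (hx : 0 ≤ x) {s t : ℝ} (hs : 0 < s) (hst : s ≤ t) : f x ^ t ≤ f x ^ s := by
  rcases (hf.nonneg x).eq_or_lt with h | h
  · rw [← h, Real.zero_rpow hs.ne', Real.zero_rpow (hs.trans_le hst).ne']
  · exact Real.rpow_le_rpow_of_exponent_ge h (hf.le_one hx) hst

/-- If one positive power is integrable, all are: larger powers are smaller as `f ≤ 1`, and for
`s < t` log-concavity with `f 0 = 1` gives `f x ^ s ≤ f ((s / t) x) ^ t`. -/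
lemma OrthantProfile.powIntegral_lt_top {n : ℕ} {f : (Fin n → ℝ) → ℝ} (hf : OrthantProfile f)
    {s t : ℝ} (hs : 0 < s) (ht : 0 < t) (hfin : powIntegral f t < ⊤) : powIntegral f s < ⊤ := by
  rcases le_or_gt t s with hst | hst
  · refine lt_of_le_of_lt ?_ hfin
    refine setLIntegral_mono_ae' measurableSet_Ici (Filter.Eventually.of_forall fun x hx => ?_)
    exact ENNReal.ofReal_le_ofReal (hf.rpow_le_rpow hx ht hst)
  · have hr : 0 < s / t := div_pos hs ht
    have h := setLIntegral_Ici_affine (0 : Fin n → ℝ) hr (fun u => ENNReal.ofReal (f u ^ t))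
    have h2 : powIntegral f s ≤
        ∫⁻ x in Set.Ici (0 : Fin n → ℝ), ENNReal.ofReal (f (0 + (s / t) • x) ^ t) := by
      refine setLIntegral_mono_ae' measurableSet_Ici (Filter.Eventually.of_forall fun x hx => ?_)
      have := hf.rpow_mul_rpow_le hx le_rfl hs hst
      rw [hf.zero, Real.one_rpow, one_mul, smul_zero] at this
      exact ENNReal.ofReal_le_ofReal this
    refine lt_of_le_of_lt h2 ?_
    refine ENNReal.lt_top_of_mul_ne_top_right (h.symm.trans_lt hfin).ne ?_
    simpa using pow_pos hr n

lemma OrthantProfile.powIntegral_dim_zero {f : (Fin 0 → ℝ) → ℝ} (hf : OrthantProfile f) (t : ℝ) :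
    powIntegral f t = 1 := by
  have h0 : ∀ x : Fin 0 → ℝ, f x = 1 := fun x => by rw [Subsingleton.elim x 0, hf.zero]
  have h1 : Set.Ici (0 : Fin 0 → ℝ) = Set.univ := by
    ext x; simp
  rw [powIntegral]
  simp_rw [h0]
  rw [h1, Measure.volume_pi_eq_dirac 0]
  simp

lemma coordSection_ge {m : ℕ} {f : (Fin (m + 1) → ℝ) → ℝ} (hf : OrthantProfile f)
    (i : Fin (m + 1)) {z : Fin (m + 1) → ℝ} (hz : 0 ≤ z) :
    f z ≤ coordSection f i (i.removeNth z) := by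
  refine hf.anti _ _ (insertNth_zero_nonneg i fun j => hz _) ?_
  rw [Fin.insertNth_le_iff]
  exact ⟨hz i, le_rfl⟩

/-- The sections appear in the slicing inequality `powIntegral_ge` with a positive weight, so they
have finite integrals. -/
lemma OrthantProfile.powIntegral_coordSection_lt_top {m : ℕ} {f : (Fin (m + 1) → ℝ) → ℝ}
    (hf : OrthantProfile f) {z : Fin (m + 1) → ℝ} (hz : ∀ i, 0 < z i) (hfz : 0 < f z)
    {s : ℝ} (hs : 0 < s) (hfin : powIntegral f s < ⊤) (i : Fin (m + 1)) :
    powIntegral (coordSection f i) s < ⊤ := by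
  have hst : s < s + 1 := by linarith
  have hK := hf.powIntegral_ge (fun i => (hz i).le) hs hst
  have htop : ENNReal.ofReal ((s + 1) ^ (m + 1)) * powIntegral f (s + 1) < ⊤ :=
    ENNReal.mul_lt_top ENNReal.ofReal_lt_top (hf.powIntegral_lt_top (by linarith) hs hfin)
  have h1 := lt_of_le_of_lt hK htop
  have h2 := ENNReal.lt_top_of_mul_ne_top_right h1.ne (by simpa using hfz)
  have h3 := (ENNReal.sum_lt_top.1 (lt_of_le_of_lt le_add_self h2)) i (Finset.mem_univ i)
  refine ENNReal.lt_top_of_mul_ne_top_right h3.ne ?_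
  have := mul_pos (mul_pos (sub_pos.2 hst) (hz i)) (pow_pos hs m)
  simpa using this

/-! ### The derivative in the exponent -/

/-- The function `t ↦ tⁿ ∫ f ^ t = ∫ f (x / t) ^ t dx`, as a real number. -/
noncomputable def scaledIntegral {n : ℕ} (f : (Fin n → ℝ) → ℝ) (t : ℝ) : ℝ :=
  t ^ n * (powIntegral f t).toReal

lemma ofReal_scaledIntegral {n : ℕ} {f : (Fin n → ℝ) → ℝ} {t : ℝ} (ht : 0 < t)
    (hfin : powIntegral f t < ⊤) :
    ENNReal.ofReal (scaledIntegral f t) = ENNReal.ofReal (t ^ n) * powIntegral f t := by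
  rw [scaledIntegral, ENNReal.ofReal_mul (by positivity), ENNReal.ofReal_toReal hfin.ne]

lemma scaledIntegral_nonneg {n : ℕ} (f : (Fin n → ℝ) → ℝ) {t : ℝ} (ht : 0 < t) :
    0 ≤ scaledIntegral f t :=
  mul_nonneg (by positivity) ENNReal.toReal_nonneg

lemma scaledIntegral_pos {n : ℕ} {f : (Fin n → ℝ) → ℝ} {t : ℝ} (ht : 0 < t)
    (hpos : 0 < powIntegral f t) (hfin : powIntegral f t < ⊤) : 0 < scaledIntegral f t :=
  mul_pos (by positivity) (ENNReal.toReal_pos hpos.ne' hfin.ne)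

/-- The slicing inequality `powIntegral_ge` for real numbers. -/
lemma OrthantProfile.scaledIntegral_ge {m : ℕ} {f : (Fin (m + 1) → ℝ) → ℝ} (hf : OrthantProfile f)
    (hfin : ∀ t, 0 < t → powIntegral f t < ⊤)
    (hfini : ∀ i t, 0 < t → powIntegral (coordSection f i) t < ⊤)
    {z : Fin (m + 1) → ℝ} (hz : 0 ≤ z) {s t : ℝ} (hs : 0 < s) (hst : s < t) :
    f z ^ (t - s) * (scaledIntegral f s
      + (t - s) * ∑ i, z i * scaledIntegral (coordSection f i) s) ≤ scaledIntegral f t := by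
  have ht := hs.trans hst
  have hK := hf.powIntegral_ge hz hs hst
  rw [← ofReal_scaledIntegral ht (hfin t ht), ← ofReal_scaledIntegral hs (hfin s hs)] at hK
  have hterm : ∀ i, ENNReal.ofReal ((t - s) * z i * s ^ m) * powIntegral (coordSection f i) s =
      ENNReal.ofReal ((t - s) * (z i * scaledIntegral (coordSection f i) s)) := by
    intro i
    have h1 : 0 ≤ (t - s) * z i := mul_nonneg (sub_pos.2 hst).le (hz i)
    rw [ENNReal.ofReal_mul h1, mul_assoc, ← ofReal_scaledIntegral hs (hfini i s hs),
      ← ENNReal.ofReal_mul h1, mul_assoc]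
  simp_rw [hterm] at hK
  have hnn : ∀ i, 0 ≤ (t - s) * (z i * scaledIntegral (coordSection f i) s) := fun i =>
    mul_nonneg (sub_pos.2 hst).le (mul_nonneg (hz i) (scaledIntegral_nonneg _ hs))
  rw [← ENNReal.ofReal_sum_of_nonneg fun i _ => hnn i,
    ← ENNReal.ofReal_add (scaledIntegral_nonneg _ hs) (Finset.sum_nonneg fun i _ => hnn i),
    ← ENNReal.ofReal_mul (Real.rpow_nonneg (hf.nonneg _) _), ← Finset.mul_sum] at hK
  exact (ENNReal.ofReal_le_ofReal_iff (scaledIntegral_nonneg _ ht)).1 hK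

lemma OrthantProfile.toReal_powIntegral {n : ℕ} {f : (Fin n → ℝ) → ℝ} (hf : OrthantProfile f)
    (t : ℝ) : (powIntegral f t).toReal = ∫ x in Set.Ici (0 : Fin n → ℝ), f x ^ t := by
  rw [integral_eq_lintegral_of_nonneg_ae
    (Filter.Eventually.of_forall fun x => Real.rpow_nonneg (hf.nonneg x) t)
    (hf.aemeasurable.pow_const t).aestronglyMeasurable]
  rfl

lemma OrthantProfile.integrable_rpow {n : ℕ} {f : (Fin n → ℝ) → ℝ} (hf : OrthantProfile f)
    {t : ℝ} (hfin : powIntegral f t < ⊤) :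
    Integrable (fun x => f x ^ t) (volume.restrict (Set.Ici (0 : Fin n → ℝ))) := by
  refine ⟨(hf.aemeasurable.pow_const t).aestronglyMeasurable, ?_⟩
  rw [hasFiniteIntegral_iff_ofReal
    (Filter.Eventually.of_forall fun x => Real.rpow_nonneg (hf.nonneg x) t)]
  exact hfin

lemma OrthantProfile.exists_hasDerivAt_scaledIntegral {n : ℕ} {f : (Fin n → ℝ) → ℝ}
    (hf : OrthantProfile f) (hfin : ∀ t, 0 < t → powIntegral f t < ⊤) {s : ℝ} (hs : 0 < s) :
    ∃ d, HasDerivAt (scaledIntegral f) d s := by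
  have h := hasDerivAt_integral_of_dominated_loc_of_deriv_le
    (μ := volume.restrict (Set.Ici (0 : Fin n → ℝ))) (F := fun t x => f x ^ t)
    (F' := fun t x => f x ^ t * Real.log (f x))
    -- half of the exponent `s / 2` absorbs the logarithm, the other half is the dominating power
    (bound := fun x => 4 / s * f x ^ (s / 4)) (x₀ := s) (Ioi_mem_nhds (by linarith : s / 2 < s))
    (Filter.Eventually.of_forall fun t => (hf.aemeasurable.pow_const t).aestronglyMeasurable)
    (hf.integrable_rpow (hfin s hs))
    ((hf.aemeasurable.pow_const s).mul hf.aemeasurable.log).aestronglyMeasurable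
    ?_ ((hf.integrable_rpow (hfin (s / 4) (by positivity))).const_mul _) ?_
  · refine ⟨_, (((hasDerivAt_id s).pow n).mul h.2).congr_of_eventuallyEq
      (Filter.Eventually.of_forall fun t => ?_)⟩
    simp [scaledIntegral, hf.toReal_powIntegral]
  · filter_upwards [ae_restrict_mem measurableSet_Ici] with x hx t ht
    rcases (hf.nonneg x).eq_or_lt with h0 | h0
    · rw [← h0]
      simp only [Real.log_zero, mul_zero, norm_zero]
      positivity
    · have h1 := (Real.abs_log_mul_self_rpow_lt (f x) (s / 4) h0 (hf.le_one hx)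
        (by positivity)).le
      have h2 : f x ^ t ≤ f x ^ (s / 4) * f x ^ (s / 4) := by
        rw [← Real.rpow_add h0]
        refine hf.rpow_le_rpow hx (by positivity) ?_
        have : s / 2 < t := ht
        linarith
      have h3 := Real.rpow_pos_of_pos h0 (s / 4)
      have h4 := Real.rpow_pos_of_pos h0 t
      rw [abs_mul, abs_of_pos h3] at h1
      rw [Real.norm_eq_abs, abs_mul, abs_of_pos h4]
      calc f x ^ t * |Real.log (f x)|
          ≤ f x ^ (s / 4) * f x ^ (s / 4) * |Real.log (f x)| := by gcongr
        _ = (|Real.log (f x)| * f x ^ (s / 4)) * f x ^ (s / 4) := by ring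
        _ ≤ 1 / (s / 4) * f x ^ (s / 4) := by gcongr
        _ = _ := by rw [one_div_div]
  · refine Filter.Eventually.of_forall fun x t ht => ?_
    have ht0 : 0 < t := lt_trans (by positivity) (Set.mem_Ioi.1 ht)
    -- at a zero of `f` the power vanishes for all exponents near `t > 0`, as does the formula
    rcases (hf.nonneg x).eq_or_lt with h0 | h0
    · rw [← h0]
      simp only [Real.log_zero, mul_zero]
      refine (hasDerivAt_const t (0 : ℝ)).congr_of_eventuallyEq ?_
      filter_upwards [lt_mem_nhds ht0] with r hr
      exact Real.zero_rpow hr.ne'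
    · have := (hasDerivAt_id t).const_rpow h0
      simpa [mul_comm] using this

/-- The infinitesimal form of `OrthantProfile.scaledIntegral_ge`, for `t ↓ s`. -/
lemma OrthantProfile.log_mul_add_le_deriv {m : ℕ} {f : (Fin (m + 1) → ℝ) → ℝ}
    (hf : OrthantProfile f)
    (hfin : ∀ t, 0 < t → powIntegral f t < ⊤)
    (hfini : ∀ i t, 0 < t → powIntegral (coordSection f i) t < ⊤)
    {z : Fin (m + 1) → ℝ} (hz : 0 ≤ z) (hfz : 0 < f z) {s d : ℝ} (hs : 0 < s)
    (hd : HasDerivAt (scaledIntegral f) d s) :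
    Real.log (f z) * scaledIntegral f s + ∑ i, z i * scaledIntegral (coordSection f i) s ≤ d := by
  set S := ∑ i, z i * scaledIntegral (coordSection f i) s with hS
  have hψ : HasDerivAt (fun t => f z ^ (t - s) * (scaledIntegral f s + (t - s) * S))
      (Real.log (f z) * scaledIntegral f s + S) s := by
    have h1 : HasDerivAt (fun t : ℝ => t - s) 1 s := (hasDerivAt_id s).sub_const s
    have h2 := (h1.const_rpow hfz).mul ((h1.mul_const S).const_add (scaledIntegral f s))
    refine h2.congr_deriv ?_
    simp
  have hdiff := hd.sub hψ
  have hslope := (hasDerivAt_iff_tendsto_slope.1 hdiff).mono_left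
    (nhdsWithin_mono s (fun x (hx : x ∈ Set.Ioi s) => (ne_of_gt hx : x ≠ s)))
  have : 0 ≤ d - (Real.log (f z) * scaledIntegral f s + S) := by
    refine ge_of_tendsto hslope ?_
    filter_upwards [self_mem_nhdsWithin] with t ht
    have ht : s < t := ht
    have hK := hf.scaledIntegral_ge hfin hfini hz hs ht
    rw [slope_def_field]
    refine div_nonneg ?_ (sub_pos.2 ht).le
    simp only [Pi.sub_apply, sub_self, Real.rpow_zero, zero_mul, add_zero, one_mul]
    linarith
  linarith

/-! ### Duality and induction on the dimension -/

/-- The inequality `g ≥ f°` on the orthant, where `f° y` is the largest `c ≥ 0` such that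
`f x * c ≤ e^{-⟨x, y⟩}` for all `x ≥ 0`. For `f = e^{-V}` it says that `g ≥ e^{-V*}`. -/
def DominatesPolar {n : ℕ} (f g : (Fin n → ℝ) → ℝ) : Prop :=
  ∀ y, 0 ≤ y → ∀ c : ℝ, 0 ≤ c → (∀ x, 0 ≤ x → f x * c ≤ Real.exp (-∑ i, x i * y i)) → c ≤ g y

/-- Domination of the polar passes to sections, because `f` is largest on the face `x i = 0` among
points with the same remaining coordinates. -/
lemma DominatesPolar.dominatesPolar_coordSection {m : ℕ} {f g : (Fin (m + 1) → ℝ) → ℝ}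
    (h : DominatesPolar f g) (hf : OrthantProfile f) (i : Fin (m + 1)) :
    DominatesPolar (coordSection f i) (coordSection g i) := by
  intro y hy c hc H
  refine h _ (insertNth_zero_nonneg i hy) c hc fun x hx => ?_
  have h1 := H (i.removeNth x) fun j => hx _
  refine (mul_le_mul_of_nonneg_right (coordSection_ge hf i hx) hc).trans (h1.trans (le_of_eq ?_))
  rw [Fin.sum_univ_succAbove _ i]
  simp [Fin.removeNth]

/-- A nonnegative function on `(0, ∞)` growing at least as fast as `t ^ (m + 1)` stays above it:
the difference is nondecreasing, and it is at least `-t ^ (m + 1)`, which tends to `0` at `0`. -/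
lemma pow_le_of_nonneg_of_le_deriv (m : ℕ) {c c' : ℝ → ℝ} (hc : ∀ t, 0 < t → 0 ≤ c t)
    (hd : ∀ t, 0 < t → HasDerivAt c (c' t) t) (hle : ∀ t, 0 < t → (m + 1 : ℝ) * t ^ m ≤ c' t)
    {t : ℝ} (ht : 0 < t) : t ^ (m + 1) ≤ c t := by
  have hmono : MonotoneOn (fun t => c t - t ^ (m + 1)) (Set.Ioi 0) := by
    have hd' : ∀ t ∈ Set.Ioi (0 : ℝ),
        HasDerivAt (fun t => c t - t ^ (m + 1)) (c' t - (m + 1 : ℝ) * t ^ m) t := by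
      intro t ht
      exact ((hd t ht).sub (hasDerivAt_pow (m + 1) t)).congr_deriv (by simp)
    refine monotoneOn_of_deriv_nonneg (convex_Ioi 0)
      (fun t ht => (hd' t ht).continuousAt.continuousWithinAt) ?_ ?_
    · rw [interior_Ioi]
      exact fun t ht => (hd' t ht).differentiableAt.differentiableWithinAt
    · rw [interior_Ioi]
      intro t ht
      rw [(hd' t ht).deriv]
      exact sub_nonneg.2 (hle t ht)
  have hlim : Filter.Tendsto (fun r : ℝ => -r ^ (m + 1)) (nhdsWithin 0 (Set.Ioi 0)) (nhds 0) := by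
    have : ContinuousAt (fun r : ℝ => -r ^ (m + 1)) 0 := by fun_prop
    have h := this.tendsto
    simp only [ne_eq, Nat.add_eq_zero_iff, one_ne_zero, and_false, not_false_eq_true, zero_pow,
      neg_zero] at h
    exact h.mono_left nhdsWithin_le_nhds
  have h0 : 0 ≤ c t - t ^ (m + 1) := by
    refine le_of_tendsto hlim ?_
    filter_upwards [Ioo_mem_nhdsGT ht] with r hr
    have h1 := hmono (Set.mem_Ioi.2 hr.1) (Set.mem_Ioi.2 ht) hr.2.le
    have h2 := hc r hr.1
    simp only at h1
    linarith
  linarith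

/-- With `a = scaledIntegral f` and `aᵢ = scaledIntegral (coordSection f i)`, the vector
`y = (aᵢ / a)ᵢ` satisfies `e^{-a' / a} ≤ g y`. -/
lemma OrthantProfile.exp_neg_le_polar {m : ℕ} {f g : (Fin (m + 1) → ℝ) → ℝ}
    (hf : OrthantProfile f) (hfg : DominatesPolar f g)
    (hfin : ∀ t, 0 < t → powIntegral f t < ⊤)
    (hfini : ∀ i t, 0 < t → powIntegral (coordSection f i) t < ⊤) {s d : ℝ} (hs : 0 < s)
    (hd : HasDerivAt (scaledIntegral f) d s) (hpos : 0 < scaledIntegral f s) :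
    Real.exp (-(d / scaledIntegral f s))
      ≤ g fun i => scaledIntegral (coordSection f i) s / scaledIntegral f s := by
  refine hfg _ (fun i => div_nonneg (scaledIntegral_nonneg _ hs) hpos.le) _ (Real.exp_pos _).le
    fun x hx => ?_
  rcases (hf.nonneg x).eq_or_lt with h0 | h0
  · rw [← h0, zero_mul]; exact (Real.exp_pos _).le
  · have h := hf.log_mul_add_le_deriv hfin hfini hx h0 hs hd
    rw [← Real.exp_log h0, ← Real.exp_add, Real.exp_le_exp]
    simp_rw [← mul_div_assoc]
    rw [← Finset.sum_div]
    have : Real.log (f x) = Real.log (f x) * scaledIntegral f s / scaledIntegral f s := by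
      field_simp
    rw [this, ← neg_div, ← neg_div, ← add_div]
    gcongr
    linarith

/-- The inequality `tⁿ ≤ a(t) b(t)` for `a(t) = tⁿ ∫ f ^ t` and `b(t) = tⁿ ∫ g ^ t`, by induction on
the dimension. At `t = 1` it is the inverse Santaló inequality on the orthant; having all `t > 0`
is what makes the differential inequality `(a b)' ≥ ∑ aᵢ bᵢ ≥ n tⁿ⁻¹` available. -/
theorem OrthantProfile.pow_le_scaled_mul_scaled (n : ℕ) : ∀ {f g : (Fin n → ℝ) → ℝ},
    OrthantProfile f → OrthantProfile g → DominatesPolar f g →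
    ∀ {z : Fin n → ℝ}, (∀ i, 0 < z i) → 0 < f z → (∀ t, 0 < t → powIntegral f t < ⊤) →
    ∀ {t : ℝ}, 0 < t → ENNReal.ofReal (t ^ n) ≤
      ENNReal.ofReal (t ^ n) * powIntegral f t * (ENNReal.ofReal (t ^ n) * powIntegral g t) := by
  induction n with
  | zero =>
    intro f g hf hg _ z _ _ _ t _
    simp [hf.powIntegral_dim_zero, hg.powIntegral_dim_zero]
  | succ m ih =>
    intro f g hf hg hfg z hz hfz hfin t ht
    have hpos : ∀ t, 0 < t → 0 < powIntegral f t := fun t ht => hf.powIntegral_pos hz hfz ht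
    -- an infinite integral of a power of `g` leaves nothing to prove
    by_cases hgtop : powIntegral g t = ⊤
    · rw [hgtop, ENNReal.mul_top (by simpa using pow_pos ht (m + 1)), ENNReal.mul_top]
      · exact le_top
      · exact mul_ne_zero (by simpa using pow_pos ht (m + 1)) (hpos t ht).ne'
    have hgfin : ∀ t, 0 < t → powIntegral g t < ⊤ := fun s hs =>
      hg.powIntegral_lt_top hs ht (lt_top_iff_ne_top.2 hgtop)
    have hfini : ∀ i t, 0 < t → powIntegral (coordSection f i) t < ⊤ := fun i t ht =>
      hf.powIntegral_coordSection_lt_top hz hfz ht (hfin t ht) i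
    have hfipos : ∀ i t, 0 < t → 0 < powIntegral (coordSection f i) t := fun i t ht =>
      (hf.profile_coordSection i).powIntegral_pos (z := i.removeNth z) (fun j => hz _)
        (hfz.trans_le (coordSection_ge hf i fun j => (hz j).le)) ht
    have hapos : ∀ t, 0 < t → 0 < scaledIntegral f t := fun t ht =>
      scaledIntegral_pos ht (hpos t ht) (hfin t ht)
    have haipos : ∀ i t, 0 < t → 0 < scaledIntegral (coordSection f i) t := fun i t ht =>
      scaledIntegral_pos ht (hfipos i t ht) (hfini i t ht)
    choose! a' ha' using fun s (hs : 0 < s) => hf.exists_hasDerivAt_scaledIntegral hfin hs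
    choose! b' hb' using fun s (hs : 0 < s) => hg.exists_hasDerivAt_scaledIntegral hgfin hs
    -- the point at which the bounds for `a'` and `b'` are coupled by duality
    set y : ℝ → Fin (m + 1) → ℝ := fun s i =>
      scaledIntegral (coordSection f i) s / scaledIntegral f s with hy
    have hypos : ∀ s, 0 < s → ∀ i, 0 < y s i := fun s hs i => div_pos (haipos i s hs) (hapos s hs)
    have hgy : ∀ s, 0 < s → Real.exp (-(a' s / scaledIntegral f s)) ≤ g (y s) := fun s hs =>
      hf.exp_neg_le_polar hfg hfin hfini hs (ha' s hs) (hapos s hs)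
    -- in particular `g` is positive at an interior point, so its sections have finite integrals
    have hgypos : ∀ s, 0 < s → 0 < g (y s) := fun s hs => (Real.exp_pos _).trans_le (hgy s hs)
    have hgini : ∀ i t, 0 < t → powIntegral (coordSection g i) t < ⊤ := fun i t ht =>
      hg.powIntegral_coordSection_lt_top (hypos t ht) (hgypos t ht) ht (hgfin t ht) i
    have hind : ∀ i s, 0 < s →
        s ^ m ≤ scaledIntegral (coordSection f i) s * scaledIntegral (coordSection g i) s := by
      intro i s hs
      have h := ih (hf.profile_coordSection i) (hg.profile_coordSection i)
        (hfg.dominatesPolar_coordSection hf i) (z := i.removeNth z) (fun j => hz _)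
        (hfz.trans_le (coordSection_ge hf i fun j => (hz j).le)) (hfini i) hs
      rw [← ofReal_scaledIntegral hs (hfini i s hs), ← ofReal_scaledIntegral hs (hgini i s hs),
        ← ENNReal.ofReal_mul (scaledIntegral_nonneg _ hs)] at h
      exact (ENNReal.ofReal_le_ofReal_iff
        (mul_nonneg (scaledIntegral_nonneg _ hs) (scaledIntegral_nonneg _ hs))).1 h
    have hderiv : ∀ s, 0 < s → (m + 1 : ℝ) * s ^ m ≤
        a' s * scaledIntegral g s + scaledIntegral f s * b' s := by
      intro s hs
      have h1 := hg.log_mul_add_le_deriv hgfin hgini (fun i => (hypos s hs i).le) (hgypos s hs) hs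
        (hb' s hs)
      have h2 : -(a' s / scaledIntegral f s) ≤ Real.log (g (y s)) := by
        rw [Real.le_log_iff_exp_le (hgypos s hs)]; exact hgy s hs
      have h3 := mul_le_mul_of_nonneg_right h2 (scaledIntegral_nonneg g hs)
      have h4 := mul_le_mul_of_nonneg_left ((add_le_add_left h3 _).trans h1) (hapos s hs).le
      have h5 : (m + 1 : ℝ) * s ^ m ≤
          ∑ i, scaledIntegral (coordSection f i) s * scaledIntegral (coordSection g i) s := by
        refine le_trans (le_of_eq ?_) (Finset.sum_le_sum fun i (_ : i ∈ Finset.univ) => hind i s hs)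
        simp
      have h6 : scaledIntegral f s * ∑ i, y s i * scaledIntegral (coordSection g i) s =
          ∑ i, scaledIntegral (coordSection f i) s * scaledIntegral (coordSection g i) s := by
        rw [Finset.mul_sum]
        refine Finset.sum_congr rfl fun i _ => ?_
        have := (hapos s hs).ne'
        simp only [hy]
        field_simp
      have h7 : scaledIntegral f s * (-(a' s / scaledIntegral f s) * scaledIntegral g s) =
          -(a' s * scaledIntegral g s) := by
        have := (hapos s hs).ne'
        field_simp
      rw [mul_add, h6, h7] at h4
      linarith
    have hmain := pow_le_of_nonneg_of_le_deriv m
      (c := fun t => scaledIntegral f t * scaledIntegral g t)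
      (fun t ht => mul_nonneg (scaledIntegral_nonneg f ht) (scaledIntegral_nonneg g ht))
      (fun t ht => (ha' t ht).mul (hb' t ht)) hderiv ht
    rw [← ofReal_scaledIntegral ht (hfin t ht), ← ofReal_scaledIntegral ht (hgfin t ht),
      ← ENNReal.ofReal_mul (scaledIntegral_nonneg _ ht)]
    exact ENNReal.ofReal_le_ofReal hmain

/-! ### The polar of a profile -/

/-- The multiplicative polar of `f` on the orthant: `polar f y` is the largest `c ≥ 0` such that
`f x * c ≤ e^{-⟨x, y⟩}` for all `x ≥ 0`. For `f = e^{-V}` it is `e^{-V*}`. -/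
noncomputable def polar {n : ℕ} (f : (Fin n → ℝ) → ℝ) (y : Fin n → ℝ) : ℝ :=
  sSup {c | 0 ≤ c ∧ ∀ x, 0 ≤ x → f x * c ≤ Real.exp (-∑ i, x i * y i)}

lemma OrthantProfile.bddAbove_polar {n : ℕ} {f : (Fin n → ℝ) → ℝ} (hf : OrthantProfile f)
    (y : Fin n → ℝ) :
    BddAbove {c | 0 ≤ c ∧ ∀ x, 0 ≤ x → f x * c ≤ Real.exp (-∑ i, x i * y i)} := by
  refine ⟨1, fun c hc => ?_⟩
  have := hc.2 0 le_rfl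
  simpa [hf.zero] using this

lemma OrthantProfile.dominatesPolar_polar {n : ℕ} {f : (Fin n → ℝ) → ℝ} (hf : OrthantProfile f) :
    DominatesPolar f (polar f) :=
  fun y _ _ hc H => le_csSup (hf.bddAbove_polar y) ⟨hc, H⟩

lemma polar_nonneg {n : ℕ} (f : (Fin n → ℝ) → ℝ) (y : Fin n → ℝ) : 0 ≤ polar f y :=
  Real.sSup_nonneg fun _ hc => hc.1

lemma OrthantProfile.mul_polar_le {n : ℕ} {f : (Fin n → ℝ) → ℝ} (hf : OrthantProfile f)
    {x : Fin n → ℝ} (hx : 0 ≤ x) (y : Fin n → ℝ) :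
    f x * polar f y ≤ Real.exp (-∑ i, x i * y i) := by
  rcases (hf.nonneg x).eq_or_lt with h0 | h0
  · rw [← h0, zero_mul]; exact (Real.exp_pos _).le
  · rw [mul_comm, ← le_div_iff₀ h0]
    refine csSup_le ⟨0, le_rfl, fun x _ => ?_⟩ fun c hc => ?_
    · rw [mul_zero]; exact (Real.exp_pos _).le
    · rw [le_div_iff₀ h0, mul_comm]; exact hc.2 x hx

lemma OrthantProfile.profile_polar {n : ℕ} {f : (Fin n → ℝ) → ℝ} (hf : OrthantProfile f) :
    OrthantProfile (polar f) where
  nonneg := polar_nonneg f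
  zero := by
    refine le_antisymm ?_ (hf.dominatesPolar_polar 0 le_rfl 1 zero_le_one fun x hx => ?_)
    · simpa [hf.zero] using hf.mul_polar_le le_rfl (0 : Fin n → ℝ)
    · simpa using hf.le_one hx
  anti y y' hy hyy' := by
    refine hf.dominatesPolar_polar y hy _ (polar_nonneg f _) fun x hx => ?_
    refine (hf.mul_polar_le hx y').trans (Real.exp_le_exp.2 (neg_le_neg ?_))
    exact Finset.sum_le_sum fun i _ => mul_le_mul_of_nonneg_left (hyy' i) (hx i)
  logConcave y y' hy hy' a b ha hb hab := by
    have hp := polar_nonneg f y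
    have hp' := polar_nonneg f y'
    refine hf.dominatesPolar_polar _ (add_nonneg (smul_nonneg ha.le hy) (smul_nonneg hb.le hy'))
      _ (by positivity) fun x hx => ?_
    have hfx := hf.nonneg x
    calc f x * (polar f y ^ a * polar f y' ^ b)
        = (f x * polar f y) ^ a * (f x * polar f y') ^ b := by
          have : f x = f x ^ a * f x ^ b := by
            rw [← Real.rpow_add_of_nonneg hfx ha.le hb.le, hab, Real.rpow_one]
          rw [Real.mul_rpow hfx hp, Real.mul_rpow hfx hp']
          nth_rewrite 1 [this]
          ring
      _ ≤ Real.exp (-∑ i, x i * y i) ^ a * Real.exp (-∑ i, x i * y' i) ^ b := by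
          have h1 := hf.mul_polar_le hx y
          have h2 := hf.mul_polar_le hx y'
          gcongr
      _ = Real.exp (-∑ i, x i * (a • y + b • y') i) := by
          rw [← Real.exp_mul, ← Real.exp_mul, ← Real.exp_add]
          congr 1
          simp only [Pi.add_apply, Pi.smul_apply, smul_eq_mul, mul_add, Finset.sum_add_distrib,
            neg_mul, Finset.sum_mul]
          rw [neg_add]
          congr 2 <;> exact Finset.sum_congr rfl fun i _ => by ring

/-- The faces of the orthant are null, so a nonzero integral forces an interior point of
positivity. -/
lemma OrthantProfile.exists_pos {n : ℕ} {f : (Fin n → ℝ) → ℝ} (hf : OrthantProfile f) {t : ℝ}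
    (ht : 0 < t) (hpos : 0 < powIntegral f t) : ∃ z : Fin n → ℝ, (∀ i, 0 < z i) ∧ 0 < f z := by
  by_contra! h
  refine hpos.ne' ?_
  have hae : (Set.univ.pi fun _ => Set.Ioi 0 : Set (Fin n → ℝ)) =ᵐ[volume] Set.Ici 0 :=
    Measure.univ_pi_Ioi_ae_eq_Ici
  rw [powIntegral, ← setLIntegral_congr hae]
  refine setLIntegral_eq_zero (MeasurableSet.univ_pi fun _ => measurableSet_Ioi) fun x hx => ?_
  have : f x = 0 := le_antisymm (h x fun i => hx i (Set.mem_univ i)) (hf.nonneg x)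
  simp [this, Real.zero_rpow ht.ne']

theorem OrthantProfile.one_le_powIntegral_mul_polar {n : ℕ} {f : (Fin n → ℝ) → ℝ}
    (hf : OrthantProfile f) (hpos : 0 < powIntegral f 1) (hfin : powIntegral f 1 < ⊤) :
    1 ≤ powIntegral f 1 * powIntegral (polar f) 1 := by
  obtain ⟨z, hz, hfz⟩ := hf.exists_pos one_pos hpos
  simpa using OrthantProfile.pow_le_scaled_mul_scaled n hf hf.profile_polar hf.dominatesPolar_polar
    hz hfz
    (fun t ht => hf.powIntegral_lt_top ht one_pos hfin) one_pos

/-! ### Reduction from `ℝⁿ` to the orthant -/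

lemma measurePreserving_abs :
    MeasurePreserving (fun x : ℝ => |x|) volume ((2 : NNReal) • volume.restrict (Set.Ici 0)) := by
  refine ⟨by fun_prop, ?_⟩
  ext s hs
  rw [Measure.map_apply (by fun_prop) hs, Measure.smul_apply, Measure.restrict_apply hs]
  have h1 : (fun x : ℝ => |x|) ⁻¹' s ∩ Set.Ici 0 = s ∩ Set.Ici 0 := by
    ext x
    simp only [Set.mem_inter_iff, Set.mem_preimage, Set.mem_Ici, and_congr_left_iff]
    intro hx; rw [abs_of_nonneg hx]
  have h2 : (fun x : ℝ => |x|) ⁻¹' s \ Set.Ici 0 = -(s ∩ Set.Ioi 0) := by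
    ext x
    simp only [Set.mem_sdiff, Set.mem_preimage, Set.mem_Ici, not_le, Set.mem_neg, Set.mem_inter_iff,
      Set.mem_Ioi, neg_pos, and_congr_left_iff]
    intro hx; rw [abs_of_neg hx]
  have h3 : volume (s ∩ Set.Ioi 0) = volume (s ∩ Set.Ici (0 : ℝ)) :=
    measure_congr ((Filter.EventuallyEq.refl _ s).inter Ioi_ae_eq_Ici)
  rw [← measure_inter_add_sdiff _ (measurableSet_Ici (a := (0 : ℝ))), h1, h2, Measure.measure_neg,
    h3, ← two_mul]
  rfl

/-- Integrating over `ℝⁿ` a function of `(|x₁|, …, |xₙ|)`. -/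
lemma lintegral_comp_abs {n : ℕ} {F : (Fin n → ℝ) → ENNReal}
    (hF : AEMeasurable F (volume.restrict (Set.Ici (0 : Fin n → ℝ)))) :
    ∫⁻ x : Fin n → ℝ, F (fun i => |x i|) = 2 ^ n * ∫⁻ x in Set.Ici 0, F x := by
  have h := measurePreserving_pi (fun _ : Fin n => (volume : Measure ℝ)) _
    (fun _ => measurePreserving_abs)
  have hpi : Measure.pi (fun _ : Fin n => (2 : NNReal) • volume.restrict (Set.Ici (0 : ℝ))) =
      (2 : ENNReal) ^ n • volume.restrict (Set.Ici (0 : Fin n → ℝ)) := by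
    refine Measure.pi_eq fun s hs => ?_
    rw [Measure.smul_apply, Measure.restrict_apply (MeasurableSet.univ_pi hs), ← Set.pi_univ_Ici,
      ← Set.pi_inter_distrib, volume_pi_pi]
    have : ∀ i, ((2 : NNReal) • volume.restrict (Set.Ici (0 : ℝ))) (s i) =
        2 * volume (s i ∩ Set.Ici 0) := fun i => by
      rw [Measure.smul_apply, Measure.restrict_apply (hs i)]; rfl
    simp [this, Finset.prod_mul_distrib]
  rw [hpi, ← volume_pi] at h
  have h2 := lintegral_map' (μ := volume) (f := F) (g := fun (x : Fin n → ℝ) i => |x i|)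
    (h.map_eq ▸ hF.smul_measure _) h.measurable.aemeasurable
  rw [← h2, h.map_eq, lintegral_smul_measure, smul_eq_mul]

/-! ### Unconditional convex functions -/

lemma Unconditional.apply_eq_of_abs_eq {n : ℕ} {V : EuclideanSpace ℝ (Fin n) → EReal}
    (hV : Unconditional V) {x y : EuclideanSpace ℝ (Fin n)} (h : ∀ i, |x i| = |y i|) :
    V x = V y := by
  rw [hV x, hV y]; simp only [h]

/-- Convexity along the segment from `y` to its reflection `y'` in the hyperplane `x i = 0` shows
that shrinking the coordinate `y i` does not increase `V`. -/
lemma ConvexFun.apply_update_le {n : ℕ} {V : EuclideanSpace ℝ (Fin n) → EReal}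
    (hconv : ConvexFun V) (hunc : Unconditional V) (y : Fin n → ℝ) (i : Fin n) {c : ℝ}
    (hc : 0 ≤ c) (hcy : c ≤ y i) :
    V (WithLp.toLp 2 (Function.update y i c)) ≤ V (WithLp.toLp 2 y) := by
  rcases hcy.eq_or_lt with h | h
  · rw [h, Function.update_eq_self]
  have hyi : 0 < y i := hc.trans_lt h
  have hab : (y i + c) / (2 * y i) + (y i - c) / (2 * y i) = 1 := by field_simp; ring
  have ha : 0 < (y i + c) / (2 * y i) := by positivity
  have hb : 0 < (y i - c) / (2 * y i) := div_pos (sub_pos.2 h) (by positivity)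
  have key := hconv (WithLp.toLp 2 y) (WithLp.toLp 2 (Function.update y i (-y i))) _ _ ha hb hab
  have hrefl : V (WithLp.toLp 2 (Function.update y i (-y i))) = V (WithLp.toLp 2 y) := by
    refine hunc.apply_eq_of_abs_eq fun j => ?_
    by_cases hj : j = i
    · subst hj; simp
    · simp [hj]
  have hpt : ((y i + c) / (2 * y i)) • WithLp.toLp 2 y +
      ((y i - c) / (2 * y i)) • WithLp.toLp 2 (Function.update y i (-y i)) =
      (WithLp.toLp 2 (Function.update y i c) : EuclideanSpace ℝ (Fin n)) := by
    ext j
    by_cases hj : j = i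
    · subst hj; simp; field_simp; ring
    · simp only [PiLp.add_apply, PiLp.smul_apply, smul_eq_mul, Function.update_of_ne hj]
      rw [← add_mul, hab, one_mul]
  rw [hpt, hrefl, ← EReal.right_distrib_of_nonneg (by exact_mod_cast ha.le)
    (by exact_mod_cast hb.le), ← EReal.coe_add, hab, EReal.coe_one, one_mul] at key
  exact key

/-- An unconditional convex function is coordinatewise nondecreasing on the orthant. -/
lemma ConvexFun.mono_orthant {n : ℕ} {V : EuclideanSpace ℝ (Fin n) → EReal}
    (hconv : ConvexFun V) (hunc : Unconditional V) {x y : Fin n → ℝ} (hx : 0 ≤ x) (hxy : x ≤ y) :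
    V (WithLp.toLp 2 x) ≤ V (WithLp.toLp 2 y) := by
  have h : ∀ S : Finset (Fin n), V (WithLp.toLp 2 (S.piecewise x y)) ≤ V (WithLp.toLp 2 y) := by
    intro S
    induction S using Finset.induction_on with
    | empty => simp
    | insert i S hi ih =>
      rw [Finset.piecewise_insert]
      refine (hconv.apply_update_le hunc _ i (hx i) ?_).trans ih
      rw [Finset.piecewise_eq_of_notMem _ _ _ hi]
      exact hxy i
  simpa using h Finset.univ

/-- The function `e^{v - V}` on `ℝⁿ`, as a real-valued function; it vanishes where `V = ∞`. The
constant `v` is meant to be `V 0`, which normalizes the value at the origin to `1`. -/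
noncomputable def expProfile {n : ℕ} (V : EuclideanSpace ℝ (Fin n) → EReal) (v : ℝ)
    (x : Fin n → ℝ) : ℝ :=
  if V (WithLp.toLp 2 x) = ⊤ then 0 else Real.exp (v - (V (WithLp.toLp 2 x)).toReal)

lemma expProfile_of_eq {n : ℕ} {V : EuclideanSpace ℝ (Fin n) → EReal} {v u : ℝ} {x : Fin n → ℝ}
    (h : V (WithLp.toLp 2 x) = u) : expProfile V v x = Real.exp (v - u) := by
  simp [expProfile, h]

lemma expProfile_of_top {n : ℕ} {V : EuclideanSpace ℝ (Fin n) → EReal} {v : ℝ} {x : Fin n → ℝ}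
    (h : V (WithLp.toLp 2 x) = ⊤) : expProfile V v x = 0 := by
  simp [expProfile, h]

lemma exp_neg_eq_expProfile {n : ℕ} {V : EuclideanSpace ℝ (Fin n) → EReal} (hV : ∀ x, V x ≠ ⊥)
    (v : ℝ) (x : Fin n → ℝ) : EReal.exp (-(V (WithLp.toLp 2 x))) =
      ENNReal.ofReal (Real.exp (-v)) * ENNReal.ofReal (expProfile V v x) := by
  rcases eq_or_ne (V (WithLp.toLp 2 x)) ⊤ with h | h
  · simp [expProfile_of_top h, h]
  · have hu := (EReal.coe_toReal h (hV _)).symm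
    rw [expProfile_of_eq hu, hu, ← EReal.coe_neg, EReal.exp_coe,
      ← ENNReal.ofReal_mul (Real.exp_pos _).le, ← Real.exp_add]
    congr 2
    rw [EReal.toReal_coe]
    ring

lemma orthantProfile_expProfile {n : ℕ} {V : EuclideanSpace ℝ (Fin n) → EReal}
    (hV : ∀ x, V x ≠ ⊥) (hconv : ConvexFun V) (hunc : Unconditional V) {v : ℝ}
    (hv : V 0 = v) : OrthantProfile (expProfile V v) where
  nonneg x := by
    rw [expProfile]; split_ifs
    · exact le_rfl
    · exact (Real.exp_pos _).le
  zero := by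
    rw [expProfile_of_eq (u := v) (by simpa using hv)]; simp
  anti x y hx hxy := by
    have h := hconv.mono_orthant hunc hx hxy
    rcases eq_or_ne (V (WithLp.toLp 2 y)) ⊤ with hy | hy
    · rw [expProfile_of_top hy, expProfile]; split_ifs
      · exact le_rfl
      · exact (Real.exp_pos _).le
    · have hx' : V (WithLp.toLp 2 x) ≠ ⊤ := (h.trans_lt hy.lt_top).ne
      rw [expProfile, expProfile, if_neg hy, if_neg hx', Real.exp_le_exp]
      have := EReal.toReal_le_toReal h (hV _) hy
      linarith
  logConcave x y _ _ a b ha hb hab := by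
    have h := hconv (WithLp.toLp 2 x) (WithLp.toLp 2 y) a b ha hb hab
    have hnn : 0 ≤ expProfile V v (a • x + b • y) := by
      rw [expProfile]; split_ifs
      · exact le_rfl
      · exact (Real.exp_pos _).le
    rcases eq_or_ne (V (WithLp.toLp 2 x)) ⊤ with hx | hx
    · rwa [expProfile_of_top hx, Real.zero_rpow ha.ne', zero_mul]
    rcases eq_or_ne (V (WithLp.toLp 2 y)) ⊤ with hy | hy
    · rwa [expProfile_of_top hy, Real.zero_rpow hb.ne', mul_zero]
    have hx' := (EReal.coe_toReal hx (hV _)).symm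
    have hy' := (EReal.coe_toReal hy (hV _)).symm
    rw [expProfile_of_eq hx', expProfile_of_eq hy']
    set p := (V (WithLp.toLp 2 x)).toReal
    set q := (V (WithLp.toLp 2 y)).toReal
    rw [hx', hy', ← EReal.coe_mul, ← EReal.coe_mul, ← EReal.coe_add, ← WithLp.toLp_smul,
      ← WithLp.toLp_smul, ← WithLp.toLp_add] at h
    have hz : V (WithLp.toLp 2 (a • x + b • y)) ≠ ⊤ := (h.trans_lt (EReal.coe_lt_top _)).ne
    have hz' := (EReal.coe_toReal hz (hV _)).symm
    rw [expProfile_of_eq hz', ← Real.exp_mul, ← Real.exp_mul, ← Real.exp_add, Real.exp_le_exp]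
    rw [hz', EReal.coe_le_coe_iff] at h
    have : v = v * a + v * b := by rw [← mul_add, hab, mul_one]
    linarith

lemma expIntegral_eq_lintegral_pi {n : ℕ} (V : EuclideanSpace ℝ (Fin n) → EReal) :
    expIntegral V = ∫⁻ x : Fin n → ℝ, EReal.exp (-(V (WithLp.toLp 2 x))) :=
  ((PiLp.volume_preserving_toLp (Fin n)).lintegral_comp_emb
    (MeasurableEquiv.toLp 2 (Fin n → ℝ)).measurableEmbedding
    (fun x => EReal.exp (-(V x)))).symm

lemma expIntegral_eq {n : ℕ} {V : EuclideanSpace ℝ (Fin n) → EReal} (hV : ∀ x, V x ≠ ⊥)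
    (hconv : ConvexFun V) (hunc : Unconditional V) {v : ℝ} (hv : V 0 = v) :
    expIntegral V =
      ENNReal.ofReal (Real.exp (-v)) * (2 ^ n * powIntegral (expProfile V v) 1) := by
  have hf := orthantProfile_expProfile hV hconv hunc hv
  rw [expIntegral_eq_lintegral_pi, powIntegral, ← lintegral_comp_abs (hf.aemeasurable_rpow 1),
    ← lintegral_const_mul' _ _ ENNReal.ofReal_ne_top]
  refine lintegral_congr fun x => ?_
  rw [Real.rpow_one, ← exp_neg_eq_expProfile hV, hunc]

/-- Integrated form of `e^{-V* y} ≥ e^v * polar (e^{v - V}) |y|`, which holds because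
`⟨x, y⟩ ≤ ⟨|x|, |y|⟩` and `V x = V |x|`. -/
lemma legendre_expIntegral_ge {n : ℕ} {V : EuclideanSpace ℝ (Fin n) → EReal} (hV : ∀ x, V x ≠ ⊥)
    (hconv : ConvexFun V) (hunc : Unconditional V) {v : ℝ} (hv : V 0 = v) :
    ENNReal.ofReal (Real.exp v) * (2 ^ n * powIntegral (polar (expProfile V v)) 1) ≤
      expIntegral (legendre V) := by
  have hf := orthantProfile_expProfile hV hconv hunc hv
  rw [expIntegral_eq_lintegral_pi, powIntegral,
    ← lintegral_comp_abs (hf.profile_polar.aemeasurable_rpow 1),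
    ← lintegral_const_mul' _ _ ENNReal.ofReal_ne_top]
  refine lintegral_mono fun y => ?_
  simp only [Real.rpow_one]
  set g := polar (expProfile V v) fun i => |y i| with hg
  rcases (polar_nonneg (expProfile V v) fun i => |y i|).eq_or_lt with h0 | h0
  · rw [hg, ← h0]; simp
  have hle : legendre V (WithLp.toLp 2 y) ≤ ((-Real.log g - v : ℝ) : EReal) := by
    refine iSup_le fun x => ?_
    rcases eq_or_ne (V x) ⊤ with hx | hx
    · simp [hx]
    have hx' := (EReal.coe_toReal hx (hV _)).symm
    have hxa : V (WithLp.toLp 2 fun i => |x i|) = ((V x).toReal : EReal) := by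
      rw [← hunc x]; exact hx'
    rw [hx', ← EReal.coe_sub, EReal.coe_le_coe_iff]
    have h1 := hf.mul_polar_le (x := fun i => |x i|) (fun i => abs_nonneg (x i)) fun i => |y i|
    rw [expProfile_of_eq hxa, ← hg, ← Real.exp_log (show 0 < g from h0), ← Real.exp_add,
      Real.exp_le_exp] at h1
    have h2 : inner ℝ x (WithLp.toLp 2 y) ≤ ∑ i, |x i| * |y i| := by
      rw [PiLp.inner_apply]
      refine Finset.sum_le_sum fun i _ => ?_
      rw [← abs_mul, show inner ℝ (x i) (y i) = x i * y i by simp [mul_comm]]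
      exact le_abs_self _
    linarith
  have h4 := EReal.exp_monotone (EReal.neg_le_neg_iff.2 hle)
  refine le_trans (le_of_eq ?_) h4
  rw [← EReal.coe_neg, EReal.exp_coe, ← ENNReal.ofReal_mul (Real.exp_pos _).le]
  congr 1
  rw [neg_sub, sub_neg_eq_add, Real.exp_add, Real.exp_log h0]

theorem theorem4p1 (n : ℕ) (V : EuclideanSpace ℝ (Fin n) → EReal)
    (hV : ∀ x, V x ≠ ⊥)
    (hconv : ConvexFun V)
    (huncond : Unconditional V)
    (hpos : 0 < expIntegral V)
    (hfin : expIntegral V < ⊤) :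
    (4 : ENNReal) ^ n ≤ expIntegral V * expIntegral (legendre V) := by
  have h0 : V 0 ≠ ⊤ := by
    intro h0
    refine hpos.ne' ?_
    -- `V` is smallest at the origin, so it would be `∞` everywhere
    have htop : ∀ x, V x = ⊤ := fun x => by
      rw [huncond x, eq_top_iff, ← h0]
      exact hconv.mono_orthant huncond le_rfl fun i => abs_nonneg (x i)
    simp [expIntegral, htop]
  obtain ⟨v, hv⟩ : ∃ v : ℝ, V 0 = v := ⟨_, (EReal.coe_toReal h0 (hV _)).symm⟩
  have hf := orthantProfile_expProfile hV hconv huncond hv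
  have hA := expIntegral_eq hV hconv huncond hv
  have hB := legendre_expIntegral_ge hV hconv huncond hv
  set A := powIntegral (expProfile V v) 1
  set B := powIntegral (polar (expProfile V v)) 1
  have hApos : 0 < A := by
    refine pos_iff_ne_zero.2 fun h => hpos.ne' ?_
    rw [hA, h, mul_zero, mul_zero]
  have hAfin : A < ⊤ := by
    refine lt_top_iff_ne_top.2 fun h => hfin.ne ?_
    rw [hA, h, ENNReal.mul_top (by simp), ENNReal.mul_top (by simpa using Real.exp_pos _)]
  have hAB : 1 ≤ A * B := hf.one_le_powIntegral_mul_polar hApos hAfin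
  have hexp : ENNReal.ofReal (Real.exp (-v)) * ENNReal.ofReal (Real.exp v) = 1 := by
    rw [← ENNReal.ofReal_mul (Real.exp_pos _).le, ← Real.exp_add]; simp
  calc (4 : ENNReal) ^ n = 4 ^ n * 1 := (mul_one _).symm
    _ ≤ 4 ^ n * (A * B) := by gcongr
    _ = (ENNReal.ofReal (Real.exp (-v)) * ENNReal.ofReal (Real.exp v)) *
          ((2 * 2) ^ n * (A * B)) := by rw [hexp, one_mul]; norm_num
    _ = ENNReal.ofReal (Real.exp (-v)) * (2 ^ n * A) *
          (ENNReal.ofReal (Real.exp v) * (2 ^ n * B)) := by rw [mul_pow]; ring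
    _ ≤ expIntegral V * expIntegral (legendre V) := by rw [hA]; gcongr
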